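/- Let $R$ be a finite commutative ring with unity $1\neq 0$, decomposed as a product $R\cong R_1\times\cdots\times R_s$ with $s\ge 1$, where each $R_i$ is a finite local ring with maximal ideal $M_i$, and suppose that $|R_i|/|M_i|\equiv 1 \pmod 4$ for every $i\in\{1,\dots,s\}$. Let $Q_R=\{u^2 : u\in R^\times\}$, $T_R=Q_R\cup(-Q_R)$, and let $\mathcal G_R=\operatorname{Cay}(R,T_R)$ be the quadratic unitary Cayley graph: its vertex set is $R$, and $u,v$ are adjacent if and only if $u-v\in T_R$. For a finite simple graph $G$ with set of symmetric arcs $\mathcal A(G)=\{(u,v) : u,v \text{ adjacent}\}$, let $N\in\mathbb C^{V(G)\times\mathcal A(G)}$ be the matrix with $N_{u,a}=1/\sqrt{\deg u}$ if $u$ is the head (second vertex) of $a$ and $N_{u,a}=0$ otherwise, let $S\in\mathbb C^{\mathcal A(G)\times\mathcal A(G)}$ be the matrix with $S_{a,b}=1$ if $a$ is the reverse of the arc $b$ and $S_{a,b}=0$ otherwise, and let $U=S(2N^*N-I)$ be the time evolution matrix of the Grover walk on $G$. The graph $G$ is called periodic if $U^\tau=I$ for some positive integer $\tau$. Then $\mathcal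 G_R$ is periodic if and only if $s=1$ and $R_1/M_1\cong\mathbb Z_5$ (as rings). -/

import Mathlib

open scoped Matrix

noncomputable section

namespace GroverWalk

variable {V : Type*} [Fintype V] [DecidableEq V] (G : SimpleGraph V) [DecidableRel G.Adj]

/-- The boundary matrix `N`, indexed by vertices and symmetric arcs (darts):
`N u a = 1 / √(deg u)` if `u` is the head of `a`, and `0` otherwise. -/
def boundaryMatrix : Matrix V G.Dart ℂ :=
  Matrix.of fun u a => if u = a.snd then ((1 / Real.sqrt (G.degree u) : ℝ) : ℂ) else 0

/-- The shift matrix `S`: `S a b = 1` if `a` is the inverse arc of `b`, and `0` otherwise. -/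
def shiftMatrix : Matrix G.Dart G.Dart ℂ :=
  Matrix.of fun a b => if a = b.symm then 1 else 0

/-- The time evolution matrix `U = S (2 N* N - I)` of the Grover walk on `G`. -/
def timeEvolution : Matrix G.Dart G.Dart ℂ :=
  shiftMatrix G * ((2 : ℂ) • ((boundaryMatrix G)ᴴ * boundaryMatrix G) - 1)

/-- The Grover walk on `G` is periodic: `U ^ τ = I` for some positive integer `τ`. -/
def IsPeriodic : Prop :=
  ∃ τ : ℕ, 0 < τ ∧ timeEvolution G ^ τ = 1

end GroverWalk

/-- The set `Q_R` of squares of units of `R`. -/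
def unitSquares (R : Type*) [CommRing R] : Set R :=
  {x | ∃ u : Rˣ, x = (u : R) ^ 2}

/-- The connection set `T_R = Q_R ∪ (-Q_R)`. -/
def quadraticConnectionSet (R : Type*) [CommRing R] : Set R :=
  unitSquares R ∪ {x | -x ∈ unitSquares R}

/-- The quadratic unitary Cayley graph `Cay(R, T_R)` on the additive group of `R`. -/
def quadraticUnitaryCayleyGraph (R : Type*) [CommRing R] : SimpleGraph R :=
  SimpleGraph.addCayley (quadraticConnectionSet R)

/-- In a nonzero ring, `u` and `v` are adjacent exactly when `u - v ∈ T_R`. -/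
theorem quadraticUnitaryCayleyGraph_adj {R : Type*} [CommRing R] [Nontrivial R] (u v : R) :
    (quadraticUnitaryCayleyGraph R).Adj u v ↔ u - v ∈ quadraticConnectionSet R := by
  have hneg : ∀ x : R, -x ∈ quadraticConnectionSet R ↔ x ∈ quadraticConnectionSet R := by
    intro x
    simp only [quadraticConnectionSet, Set.mem_union, Set.mem_ofPred_eq, neg_neg]
    exact or_comm
  have hzero : (0 : R) ∉ quadraticConnectionSet R := by
    rintro (⟨w, hw⟩ | ⟨w, hw⟩)
    · exact (w ^ 2).ne_zero (by simpa using hw.symm)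
    · exact (w ^ 2).ne_zero (by simpa using hw.symm)
  have hsymm : v - u ∈ quadraticConnectionSet R ↔ u - v ∈ quadraticConnectionSet R := by
    rw [← hneg, neg_sub]
  rw [quadraticUnitaryCayleyGraph, SimpleGraph.addCayley_adj]
  have hvu : -u + v = v - u := by ring
  have huv : -v + u = u - v := by ring
  rw [hvu, huv, hsymm, or_self]
  constructor
  · exact fun h => h.2
  · refine fun h => ⟨?_, h⟩
    rintro rfl
    exact hzero (by simpa using h)

end

/-! ### Chebyshev polynomials and integrality -/

theorem chebyshevC_monic_natDegree (n : ℕ) :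
    (Polynomial.Chebyshev.C ℤ ((n : ℤ) + 1)).Monic ∧
      (Polynomial.Chebyshev.C ℤ ((n : ℤ) + 1)).natDegree = n + 1 := by
  induction n using Nat.twoStepInduction with
  | zero => simp [Polynomial.monic_X]
  | one =>
    have h : Polynomial.Chebyshev.C ℤ (((1 : ℕ) : ℤ) + 1) = Polynomial.X ^ 2 - Polynomial.C 2 := by
      simpa using Polynomial.Chebyshev.C_two ℤ
    rw [h]
    exact ⟨Polynomial.monic_X_pow_sub_C _ two_ne_zero, Polynomial.natDegree_X_pow_sub_C⟩
  | more n ih₁ ih₂ =>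
    have h : Polynomial.Chebyshev.C ℤ (((n + 2 : ℕ) : ℤ) + 1) =
        Polynomial.X * Polynomial.Chebyshev.C ℤ (((n + 1 : ℕ) : ℤ) + 1) -
          Polynomial.Chebyshev.C ℤ ((n : ℤ) + 1) := by
      have := Polynomial.Chebyshev.C_add_two ℤ ((n : ℤ) + 1)
      push_cast at this ⊢
      convert this using 2
      ring_nf
    have hm := Polynomial.monic_X.mul ih₂.1
    have hd : (Polynomial.X * Polynomial.Chebyshev.C ℤ (((n + 1 : ℕ) : ℤ) + 1)).natDegree
        = n + 3 := by
      rw [Polynomial.monic_X.natDegree_mul ih₂.1, ih₂.2, Polynomial.natDegree_X]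
      ring
    have hlt : (Polynomial.Chebyshev.C ℤ ((n : ℤ) + 1)).degree <
        (Polynomial.X * Polynomial.Chebyshev.C ℤ (((n + 1 : ℕ) : ℤ) + 1)).degree := by
      apply Polynomial.degree_lt_degree
      rw [hd, ih₁.2]
      omega
    rw [h]
    refine ⟨hm.sub_of_left hlt, ?_⟩
    rw [Polynomial.natDegree_sub_eq_left_of_natDegree_lt (by rw [hd, ih₁.2]; omega), hd]

/-- If the Chebyshev polynomial `C n = 2 T n (X / 2)` takes the value `2` at `x`, then `x` is an
algebraic integer. -/
theorem isIntegral_of_aeval_chebyshevC_eq_two {x : ℂ} {n : ℕ} (hn : 0 < n)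
    (h : Polynomial.aeval x (Polynomial.Chebyshev.C ℤ (n : ℤ)) = 2) : IsIntegral ℤ x := by
  obtain ⟨m, rfl⟩ : ∃ m, n = m + 1 := ⟨n - 1, by omega⟩
  obtain ⟨hm, hd⟩ := chebyshevC_monic_natDegree m
  refine ⟨Polynomial.Chebyshev.C ℤ ((m : ℤ) + 1) - Polynomial.C 2, hm.sub_of_left ?_, ?_⟩
  · refine lt_of_le_of_lt Polynomial.degree_C_le ?_
    rw [Polynomial.degree_eq_natDegree hm.ne_zero, hd]
    exact_mod_cast Nat.succ_pos m
  · rw [← Polynomial.aeval_def, map_sub]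
    push_cast at h
    rw [h, map_ofNat, map_ofNat, sub_self]

/-! ### The Grover walk of a coined quantum walk, abstractly -/

section Abstract

variable {V D : Type*} [Fintype V] [DecidableEq V] [Fintype D] [DecidableEq D]
  {N : Matrix V D ℂ} {S : Matrix D D ℂ}

/-- The three-term recurrence of a quantum walk with boundary matrix `N`, shift `S` and
discriminant `N S N*`. -/
theorem walk_mul_walk_mul_conjTranspose (hN : N * Nᴴ = 1) (hS : S * S = 1) :
    (S * ((2 : ℂ) • (Nᴴ * N) - 1)) * ((S * ((2 : ℂ) • (Nᴴ * N) - 1)) * Nᴴ) =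
      (2 : ℂ) • ((S * ((2 : ℂ) • (Nᴴ * N) - 1)) * Nᴴ * (N * S * Nᴴ)) - Nᴴ := by
  have h1 : (S * ((2 : ℂ) • (Nᴴ * N) - 1)) * Nᴴ = S * Nᴴ := by
    rw [Matrix.mul_assoc, Matrix.sub_mul, Matrix.smul_mul, Matrix.mul_assoc, hN, Matrix.mul_one,
      Matrix.one_mul, two_smul, add_sub_cancel_right]
  rw [h1, Matrix.mul_assoc S, Matrix.sub_mul, Matrix.mul_sub, Matrix.one_mul,
    ← Matrix.mul_assoc S S, hS, Matrix.one_mul, Matrix.smul_mul, Matrix.mul_smul]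
  simp only [Matrix.mul_assoc]

theorem isIntegral_two_mul_of_walk_pow_eq_one (hN : N * Nᴴ = 1) (hS : S * S = 1)
    {τ : ℕ} (hτ : 0 < τ) (hU : (S * ((2 : ℂ) • (Nᴴ * N) - 1)) ^ τ = 1)
    {v : V → ℂ} (hv : v ≠ 0) {c : ℂ} (hc : (N * S * Nᴴ) *ᵥ v = c • v) :
    IsIntegral ℤ (2 * c) := by
  have hrec := walk_mul_walk_mul_conjTranspose hN hS
  have h1 : (S * ((2 : ℂ) • (Nᴴ * N) - 1)) * Nᴴ = S * Nᴴ := by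
    rw [Matrix.mul_assoc, Matrix.sub_mul, Matrix.smul_mul, Matrix.mul_assoc, hN, Matrix.mul_one,
      Matrix.one_mul, two_smul, add_sub_cancel_right]
  set U := S * ((2 : ℂ) • (Nᴴ * N) - 1) with hUdef
  have key : ∀ n : ℕ, (2 : ℂ) • (N * U ^ n * Nᴴ) *ᵥ v =
      Polynomial.aeval (2 * c) (Polynomial.Chebyshev.C ℤ (n : ℤ)) • v := by
    intro n
    induction n using Nat.twoStepInduction with
    | zero =>
      simp [hN]
      rw [show (2 : Polynomial ℤ) = Polynomial.C 2 from rfl, Polynomial.aeval_C]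
      simp
    | one =>
      rw [pow_one, Matrix.mul_assoc, h1, ← Matrix.mul_assoc, hc]
      simp [mul_smul]
    | more n ih₁ ih₂ =>
      have hC : Polynomial.Chebyshev.C ℤ ((n + 2 : ℕ) : ℤ) =
          Polynomial.X * Polynomial.Chebyshev.C ℤ ((n + 1 : ℕ) : ℤ) -
            Polynomial.Chebyshev.C ℤ (n : ℤ) := by
        push_cast
        exact Polynomial.Chebyshev.C_add_two ℤ n
      have hstep : N * U ^ (n + 2) * Nᴴ =
          (2 : ℂ) • (N * U ^ (n + 1) * Nᴴ * (N * S * Nᴴ)) - N * U ^ n * Nᴴ := by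
        rw [pow_add, pow_two, pow_succ]
        have : N * (U ^ n * (U * U)) * Nᴴ = N * U ^ n * (U * (U * Nᴴ)) := by
          simp only [Matrix.mul_assoc]
        rw [this, hrec, Matrix.mul_sub, Matrix.mul_smul]
        simp only [Matrix.mul_assoc]
      rw [hC, hstep, Matrix.sub_mulVec, Matrix.smul_mulVec, ← Matrix.mulVec_mulVec, hc,
        Matrix.mulVec_smul, smul_sub, ih₁, map_sub, map_mul, Polynomial.aeval_X, sub_smul,
        mul_smul, ← ih₂]
      ext i
      simp only [Pi.sub_apply, Pi.smul_apply, smul_eq_mul]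
      ring
  have h2 := key τ
  rw [hU, Matrix.mul_one, hN, Matrix.one_mulVec] at h2
  refine isIntegral_of_aeval_chebyshevC_eq_two hτ ?_
  obtain ⟨i, hi⟩ := Function.ne_iff.1 hv
  have h3 := congrFun h2 i
  simp only [Pi.smul_apply, smul_eq_mul] at h3
  exact (mul_right_cancel₀ hi h3).symm

omit [DecidableEq D] in
open scoped ComplexOrder in
theorem Matrix.eq_zero_of_normal_of_mul_self_eq_zero {X : Matrix D D ℂ} (hX : Xᴴ * X = X * Xᴴ)
    (h : X * X = 0) : X = 0 := by
  rw [← Matrix.conjTranspose_mul_self_eq_zero, ← Matrix.conjTranspose_mul_self_eq_zero]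
  rw [Matrix.conjTranspose_mul, Matrix.conjTranspose_conjTranspose]
  calc Xᴴ * X * (Xᴴ * X) = Xᴴ * (X * Xᴴ) * X := by simp only [Matrix.mul_assoc]
    _ = Xᴴ * Xᴴ * (X * X) := by rw [← hX]; simp only [Matrix.mul_assoc]
    _ = 0 := by rw [h, Matrix.mul_zero]

theorem walk_mem_unitary (hN : N * Nᴴ = 1) (hS : S * S = 1) (hS' : Sᴴ = S) :
    (S * ((2 : ℂ) • (Nᴴ * N) - 1))ᴴ * (S * ((2 : ℂ) • (Nᴴ * N) - 1)) = 1 := by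
  have hC : ((2 : ℂ) • (Nᴴ * N) - 1)ᴴ = (2 : ℂ) • (Nᴴ * N) - 1 := by
    simp [Matrix.conjTranspose_sub, Matrix.conjTranspose_smul, Matrix.conjTranspose_mul]
  have hK : Nᴴ * N * (Nᴴ * N) = Nᴴ * N := by
    rw [Matrix.mul_assoc, ← Matrix.mul_assoc N, hN, Matrix.one_mul]
  have hCC : ((2 : ℂ) • (Nᴴ * N) - 1) * ((2 : ℂ) • (Nᴴ * N) - 1) = 1 := by
    rw [Matrix.sub_mul, Matrix.mul_sub, Matrix.smul_mul, Matrix.mul_smul, hK, Matrix.mul_one,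
      Matrix.one_mul]
    module
  rw [Matrix.conjTranspose_mul, hC, hS', Matrix.mul_assoc, ← Matrix.mul_assoc S, hS,
    Matrix.one_mul, hCC]

/-- A walk whose discriminant `P` has spectrum in `{1, 0, cos (2π/5), cos (4π/5)}` has period
dividing `20`. -/
theorem walk_pow_twenty_eq_one (hN : N * Nᴴ = 1) (hS : S * S = 1) (hS' : Sᴴ = S)
    (hP : ((4 : ℂ) • (N * S * Nᴴ * (N * S * Nᴴ)) + (2 : ℂ) • (N * S * Nᴴ) - 1) * (N * S * Nᴴ)
      * (N * S * Nᴴ - 1) = 0) :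
    (S * ((2 : ℂ) • (Nᴴ * N) - 1)) ^ 20 = 1 := by
  have hrec := walk_mul_walk_mul_conjTranspose hN hS
  have h1 : (S * ((2 : ℂ) • (Nᴴ * N) - 1)) * Nᴴ = S * Nᴴ := by
    rw [Matrix.mul_assoc, Matrix.sub_mul, Matrix.smul_mul, Matrix.mul_assoc, hN, Matrix.mul_one,
      Matrix.one_mul, two_smul, add_sub_cancel_right]
  have hun := walk_mem_unitary hN hS hS'
  have hsq : (S * ((2 : ℂ) • (Nᴴ * N) - 1)) ^ 2 - 1 =
      Nᴴ * (-(2 : ℂ) • N) + (S * Nᴴ) * ((4 : ℂ) • (N * S * Nᴴ * N) - (2 : ℂ) • (N * S)) := by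
    have : S * ((2 : ℂ) • (Nᴴ * N) - 1) = (2 : ℂ) • (S * Nᴴ * N) - S := by
      rw [Matrix.mul_sub, Matrix.mul_smul, Matrix.mul_one, Matrix.mul_assoc]
    rw [this, pow_two, Matrix.sub_mul, Matrix.mul_sub, Matrix.mul_sub, hS, Matrix.mul_sub]
    have h5 : S * ((2 : ℂ) • (S * Nᴴ * N)) = (2 : ℂ) • (Nᴴ * N) := by
      rw [Matrix.mul_smul, ← Matrix.mul_assoc, ← Matrix.mul_assoc, hS, Matrix.one_mul]
    rw [h5]
    simp only [Matrix.mul_smul, Matrix.smul_mul, Matrix.mul_assoc, smul_smul]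
    module
  set U := S * ((2 : ℂ) • (Nᴴ * N) - 1) with hUdef
  set P := N * S * Nᴴ with hPdef
  set M := Nᴴ with hM
  have ha : (U ^ 2 + 1) * M = (2 : ℂ) • (U * M * P) := by
    rw [Matrix.add_mul, pow_two, Matrix.mul_assoc, hrec, Matrix.one_mul, sub_add_cancel]
  have hb : (U - 1) ^ 2 * M = (2 : ℂ) • (U * M * (P - 1)) := by
    have : (U - 1) ^ 2 * M = (U ^ 2 + 1) * M - (2 : ℂ) • (U * M) := by
      rw [← Matrix.smul_mul, ← Matrix.sub_mul]
      congr 1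
      rw [two_smul]
      noncomm_ring
    rw [this, ha, Matrix.mul_sub, Matrix.mul_one, smul_sub]
  have hc : (U ^ 4 + U ^ 3 + U ^ 2 + U + 1) * M =
      U ^ 2 * M * ((4 : ℂ) • (P * P) + (2 : ℂ) • P - 1) := by
    have e : (U ^ 4 + U ^ 3 + U ^ 2 + U + 1) * M =
        (U ^ 2 + 1) * ((U ^ 2 + 1) * M) + U * ((U ^ 2 + 1) * M) - U ^ 2 * M := by
      rw [← Matrix.mul_assoc, ← Matrix.mul_assoc, ← Matrix.add_mul, ← Matrix.sub_mul]
      congr 1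
      noncomm_ring
    have e' : (U ^ 2 + 1) * ((2 : ℂ) • (U * M * P)) = (4 : ℂ) • (U ^ 2 * M * (P * P)) := by
      have : (U ^ 2 + 1) * ((2 : ℂ) • (U * M * P)) = (2 : ℂ) • (U * ((U ^ 2 + 1) * M) * P) := by
        rw [Matrix.mul_smul]
        simp only [← Matrix.mul_assoc]
        congr 3
        noncomm_ring
      rw [this, ha, Matrix.mul_smul, Matrix.smul_mul, smul_smul]
      norm_num
      simp only [pow_two, Matrix.mul_assoc]
    rw [e, ha, e', Matrix.mul_sub, Matrix.mul_add, Matrix.mul_smul, Matrix.mul_smul,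
      Matrix.mul_smul, Matrix.mul_one]
    simp only [pow_two, Matrix.mul_assoc]
  have hg : (U ^ 4 + U ^ 3 + U ^ 2 + U + 1) * ((U ^ 2 + 1) * (U - 1) ^ 2) * M = 0 := by
    calc _ = (U ^ 4 + U ^ 3 + U ^ 2 + U + 1) * ((U ^ 2 + 1) * ((U - 1) ^ 2 * M)) := by
          simp only [Matrix.mul_assoc]
      _ = (2 : ℂ) • (U * (U ^ 4 + U ^ 3 + U ^ 2 + U + 1) * ((U ^ 2 + 1) * M) * (P - 1)) := by
          rw [hb, Matrix.mul_smul, Matrix.mul_smul]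
          simp only [← Matrix.mul_assoc]
          congr 3
          noncomm_ring
      _ = (4 : ℂ) • (U ^ 2 * ((U ^ 4 + U ^ 3 + U ^ 2 + U + 1) * M) * (P * (P - 1))) := by
          rw [ha, Matrix.mul_smul, Matrix.smul_mul, smul_smul]
          norm_num
          simp only [← Matrix.mul_assoc]
          congr 3
          noncomm_ring
      _ = (4 : ℂ) • (U ^ 2 * (U ^ 2 * M) *
            (((4 : ℂ) • (P * P) + (2 : ℂ) • P - 1) * P * (P - 1))) := by
          rw [hc]
          simp only [Matrix.mul_assoc]
      _ = 0 := by rw [hP, Matrix.mul_zero, smul_zero]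
  have hg' : (U ^ 4 + U ^ 3 + U ^ 2 + U + 1) * ((U ^ 2 + 1) * (U - 1) ^ 2) * (S * M) = 0 := by
    rw [← h1, ← Matrix.mul_assoc]
    have : (U ^ 4 + U ^ 3 + U ^ 2 + U + 1) * ((U ^ 2 + 1) * (U - 1) ^ 2) * U =
        U * ((U ^ 4 + U ^ 3 + U ^ 2 + U + 1) * ((U ^ 2 + 1) * (U - 1) ^ 2)) := by
      noncomm_ring
    rw [this, Matrix.mul_assoc, hg, Matrix.mul_zero]
  have hann : (U ^ 4 + U ^ 3 + U ^ 2 + U + 1) * ((U ^ 2 + 1) * (U - 1) ^ 2) * (U ^ 2 - 1) = 0 := by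
    rw [hsq, Matrix.mul_add, ← Matrix.mul_assoc, ← Matrix.mul_assoc _ (S * M), hg, hg',
      Matrix.zero_mul, Matrix.zero_mul, add_zero]
  have hcube : (U ^ 20 - 1) ^ 3 = 0 := by
    have hdvd : ((Polynomial.X ^ 4 + Polynomial.X ^ 3 + Polynomial.X ^ 2 + Polynomial.X + 1) *
        ((Polynomial.X ^ 2 + 1) * (Polynomial.X - 1) ^ 2) * (Polynomial.X ^ 2 - 1) :
          Polynomial ℤ) ∣ (Polynomial.X ^ 20 - 1) ^ 3 := by
      have d1 : ((Polynomial.X ^ 4 + Polynomial.X ^ 3 + Polynomial.X ^ 2 + Polynomial.X + 1) *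
          (Polynomial.X - 1) : Polynomial ℤ) ∣ Polynomial.X ^ 20 - 1 :=
        ⟨Polynomial.X ^ 15 + Polynomial.X ^ 10 + Polynomial.X ^ 5 + 1, by ring⟩
      have d2 : ((Polynomial.X ^ 2 + 1) * (Polynomial.X - 1) : Polynomial ℤ) ∣
          Polynomial.X ^ 20 - 1 :=
        ⟨(Polynomial.X + 1) * (Polynomial.X ^ 16 + Polynomial.X ^ 12 + Polynomial.X ^ 8 +
          Polynomial.X ^ 4 + 1), by ring⟩
      have d3 : (Polynomial.X ^ 2 - 1 : Polynomial ℤ) ∣ Polynomial.X ^ 20 - 1 := by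
        have := sub_dvd_pow_sub_pow (Polynomial.X ^ 2 : Polynomial ℤ) 1 10
        rwa [← pow_mul, one_pow] at this
      have := mul_dvd_mul (mul_dvd_mul d1 d2) d3
      convert this using 1 <;> ring
    obtain ⟨q, hq⟩ := hdvd
    have := congrArg (Polynomial.aeval U) hq
    simp only [map_mul, map_pow, map_sub, map_add, Polynomial.aeval_X, map_one] at this
    rw [this, hann, zero_mul]
  have hcomm : Commute Uᴴ U := by
    have h := mul_eq_one_comm.1 hun
    exact hun.trans h.symm
  have hX : ∀ n : ℕ, ((U ^ 20 - 1) ^ n)ᴴ * (U ^ 20 - 1) ^ n =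
      (U ^ 20 - 1) ^ n * ((U ^ 20 - 1) ^ n)ᴴ := by
    intro n
    have h : Commute (Uᴴ ^ 20 - 1) (U ^ 20 - 1) :=
      ((hcomm.pow_pow 20 20).sub_left (Commute.one_left _)).sub_right
        ((Commute.one_right _).sub_left (Commute.one_left _))
    rw [Matrix.conjTranspose_pow, Matrix.conjTranspose_sub, Matrix.conjTranspose_pow,
      Matrix.conjTranspose_one]
    exact (h.pow_pow n n).eq
  have hsquare : (U ^ 20 - 1) ^ 2 = 0 :=
    Matrix.eq_zero_of_normal_of_mul_self_eq_zero (hX 2)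
      (by rw [← pow_add, pow_succ, hcube, zero_mul])
  have hone : (U ^ 20 - 1) ^ 1 = 0 :=
    Matrix.eq_zero_of_normal_of_mul_self_eq_zero (hX 1) (by rw [← pow_add, hsquare])
  rwa [pow_one, sub_eq_zero] at hone

end Abstract

/-! ### Boundary and shift matrices of a regular graph -/

namespace GroverWalk

variable {V : Type*} [Fintype V] [DecidableEq V] (G : SimpleGraph V) [DecidableRel G.Adj]

omit [DecidableEq V] in
theorem sum_dart (f : V → V → ℂ) :
    ∑ d : G.Dart, f d.fst d.snd = ∑ u, ∑ v, if G.Adj u v then f u v else 0 := by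
  rw [← Fintype.sum_prod_type' (f := fun u v => if G.Adj u v then f u v else 0),
    ← Finset.sum_filter]
  refine Finset.sum_bij (fun d _ => d.toProd) ?_ ?_ ?_ ?_
  · intro d _
    simp
  · intro a _ b _ h
    exact SimpleGraph.Dart.ext _ _ h
  · intro p hp
    exact ⟨⟨p, by simpa using hp⟩, Finset.mem_univ _, rfl⟩
  · intro d _
    rfl

theorem shiftMatrix_mul_shiftMatrix : shiftMatrix G * shiftMatrix G = 1 := by
  ext a b
  simp only [shiftMatrix, Matrix.mul_apply, Matrix.of_apply, Matrix.one_apply]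
  rw [Finset.sum_eq_single b.symm]
  · simp
  · intro d _ hd
    simp [hd]
  · simp

omit [Fintype V] [DecidableRel G.Adj] in
theorem conjTranspose_shiftMatrix : (shiftMatrix G)ᴴ = shiftMatrix G := by
  ext a b
  simp only [shiftMatrix, Matrix.conjTranspose_apply, Matrix.of_apply]
  have : b = a.symm ↔ a = b.symm := by
    constructor <;> rintro rfl <;> simp
  simp [this, apply_ite]

variable {G} {k : ℕ}

theorem boundaryMatrix_apply_of_regular (hk : ∀ v, G.degree v = k) (u : V) (a : G.Dart) :
    boundaryMatrix G u a = if u = a.snd then ((1 / Real.sqrt k : ℝ) : ℂ) else 0 := by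
  simp [boundaryMatrix, hk]

theorem ofReal_one_div_sqrt_mul_self (k : ℕ) :
    ((1 / Real.sqrt k : ℝ) : ℂ) * ((1 / Real.sqrt k : ℝ) : ℂ) = 1 / k := by
  rw [← Complex.ofReal_mul, div_mul_div_comm, Real.mul_self_sqrt (Nat.cast_nonneg k)]
  simp

theorem boundaryMatrix_mul_conjTranspose (hk : ∀ v, G.degree v = k) (hk0 : k ≠ 0) :
    boundaryMatrix G * (boundaryMatrix G)ᴴ = 1 := by
  ext u v
  simp only [Matrix.mul_apply, Matrix.conjTranspose_apply, boundaryMatrix_apply_of_regular hk]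
  have h : ∀ a : G.Dart, ((if u = a.snd then ((1 / Real.sqrt k : ℝ) : ℂ) else 0) *
      star (if v = a.snd then ((1 / Real.sqrt k : ℝ) : ℂ) else 0)) =
      (fun _ y => if u = y then if v = y then (1 / k : ℂ) else 0 else 0) a.fst a.snd := by
    intro a
    have := ofReal_one_div_sqrt_mul_self k
    by_cases h1 : u = a.snd <;> by_cases h2 : v = a.snd <;>
      simp only [h1, h2, if_true, if_false, star_zero, mul_zero, zero_mul]
    rw [← this]
    congr 1
    exact Complex.conj_ofReal _
  simp_rw [h]
  rw [sum_dart G (fun _ y => if u = y then if v = y then (1 / k : ℂ) else 0 else 0),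
    Finset.sum_comm, Finset.sum_eq_single u]
  · by_cases huv : u = v
    · subst huv
      have hd := hk u
      rw [← SimpleGraph.card_neighborFinset_eq_degree] at hd
      simp only [if_true, Matrix.one_apply_eq]
      rw [← Finset.sum_filter, Finset.sum_const, nsmul_eq_mul]
      have : (Finset.univ.filter fun x => G.Adj x u) = G.neighborFinset u := by
        ext x
        simp [G.adj_comm]
      rw [this, hd]
      field_simp
    · simp [huv, Ne.symm huv]
  · intro b _ hb
    simp [Ne.symm hb]
  · simp

theorem discriminant_apply (hk : ∀ v, G.degree v = k) (u v : V) :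
    (boundaryMatrix G * shiftMatrix G * (boundaryMatrix G)ᴴ) u v =
      if G.Adj u v then (1 / k : ℂ) else 0 := by
  have hNS : ∀ a, (boundaryMatrix G * shiftMatrix G) u a =
      if u = a.fst then ((1 / Real.sqrt k : ℝ) : ℂ) else 0 := by
    intro a
    simp only [Matrix.mul_apply, boundaryMatrix_apply_of_regular hk, shiftMatrix, Matrix.of_apply]
    rw [Finset.sum_eq_single a.symm]
    · simp
    · intro d _ hd
      simp [hd]
    · simp
  rw [Matrix.mul_apply]
  simp only [hNS, Matrix.conjTranspose_apply, boundaryMatrix_apply_of_regular hk]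
  have h : ∀ a : G.Dart, ((if u = a.fst then ((1 / Real.sqrt k : ℝ) : ℂ) else 0) *
      star (if v = a.snd then ((1 / Real.sqrt k : ℝ) : ℂ) else 0)) =
      (fun x y => if u = x then if v = y then (1 / k : ℂ) else 0 else 0) a.fst a.snd := by
    intro a
    have := ofReal_one_div_sqrt_mul_self k
    by_cases h1 : u = a.fst <;> by_cases h2 : v = a.snd <;>
      simp only [h1, h2, if_true, if_false, star_zero, mul_zero, zero_mul]
    rw [← this]
    congr 1
    exact Complex.conj_ofReal _
  simp_rw [h]
  rw [sum_dart G (fun x y => if u = x then if v = y then (1 / k : ℂ) else 0 else 0),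
    Finset.sum_eq_single u, Finset.sum_eq_single v]
  · simp
  · intro b _ hb
    simp [Ne.symm hb]
  · simp
  · intro b _ hb
    simp [Ne.symm hb]
  · simp

theorem IsPeriodic.isIntegral (hG : IsPeriodic G) (hk : ∀ v, G.degree v = k) (hk0 : k ≠ 0)
    {f : V → ℂ} (hf : f ≠ 0) {c : ℂ}
    (hc : ∀ u, ∑ v, (if G.Adj u v then f v else 0) = (k * c) * f u) :
    IsIntegral ℤ (2 * c) := by
  obtain ⟨τ, hτ, hU⟩ := hG
  refine isIntegral_two_mul_of_walk_pow_eq_one (boundaryMatrix_mul_conjTranspose hk hk0)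
    (shiftMatrix_mul_shiftMatrix G) hτ hU hf ?_
  ext u
  have hk0' : (k : ℂ) ≠ 0 := by exact_mod_cast hk0
  simp only [Matrix.mulVec, dotProduct, discriminant_apply hk, Pi.smul_apply, smul_eq_mul]
  have : ∀ v, (if G.Adj u v then (1 / k : ℂ) else 0) * f v =
      (1 / k) * (if G.Adj u v then f v else 0) := by
    intro v
    split_ifs <;> simp
  simp_rw [this]
  rw [← Finset.mul_sum, hc]
  field_simp

theorem isPeriodic_of_discriminant (hk : ∀ v, G.degree v = k) (hk0 : k ≠ 0) {P : Matrix V V ℂ}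
    (hP : ∀ u v, P u v = if G.Adj u v then (1 / k : ℂ) else 0)
    (h : ((4 : ℂ) • (P * P) + (2 : ℂ) • P - 1) * P * (P - 1) = 0) : IsPeriodic G := by
  have : boundaryMatrix G * shiftMatrix G * (boundaryMatrix G)ᴴ = P := by
    ext u v
    rw [discriminant_apply hk, hP]
  refine ⟨20, by norm_num, walk_pow_twenty_eq_one (boundaryMatrix_mul_conjTranspose hk hk0)
    (shiftMatrix_mul_shiftMatrix G) (conjTranspose_shiftMatrix G) ?_⟩
  rw [this]
  exact h

end GroverWalk

/-! ### Averages along group homomorphisms -/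

@[to_additive card_mul_sum_comp_addMonoidHom_of_surjective]
theorem card_mul_sum_comp_monoidHom_of_surjective {G H : Type*} [Group G] [Fintype G] [Group H] [Fintype H]
    (φ : G →* H) (hφ : Function.Surjective φ) (f : H → ℂ) :
    (Fintype.card H : ℂ) * ∑ x, f (φ x) = Fintype.card G * ∑ y, f y := by
  classical
  have hfib : ∀ y, (Finset.univ.filter fun x => φ x = y).card =
      (Finset.univ.filter fun x => φ x = 1).card :=
    fun y => MonoidHom.card_fiber_eq_of_mem_range φ (hφ y) (hφ 1)
  have hcard : Fintype.card G = Fintype.card H * (Finset.univ.filter fun x => φ x = 1).card := by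
    rw [← Finset.card_univ, Finset.card_eq_sum_card_fiberwise (f := φ) (t := Finset.univ)
      (fun _ _ => Finset.mem_coe.2 (Finset.mem_univ _))]
    simp [hfib]
  have hsum : ∑ x, f (φ x) = (Finset.univ.filter fun x => φ x = 1).card * ∑ y, f y := by
    rw [← Finset.sum_fiberwise (g := φ), Finset.mul_sum]
    refine Finset.sum_congr rfl fun y _ => ?_
    rw [Finset.sum_congr rfl (g := fun _ => f y) (fun x hx => by rw [(Finset.mem_filter.1 hx).2]),
      Finset.sum_const, hfib, nsmul_eq_mul]
  rw [hsum, hcard]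
  push_cast
  ring

/-! ### Spectrum of quadratic unitary Cayley graphs via additive characters -/

section Cayley

variable (R : Type*) [CommRing R]

/-- The homomorphism `(ε, u) ↦ ε u²`, whose range is the connection set `T_R`. -/
noncomputable def signedSquareHom : ℤˣ × Rˣ →* Rˣ :=
  MonoidHom.coprod (Units.map (Int.castRingHom R : ℤ →* R)) (powMonoidHom 2)

variable {R}

theorem coe_signedSquareHom (p : ℤˣ × Rˣ) :
    (signedSquareHom R p : R) = ((p.1 : ℤ) : R) * (p.2 : R) ^ 2 := by
  simp [signedSquareHom]

theorem mem_quadraticConnectionSet_iff {x : R} :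
    x ∈ quadraticConnectionSet R ↔ ∃ p, (signedSquareHom R p : R) = x := by
  constructor
  · rintro (⟨u, hu⟩ | ⟨u, hu⟩)
    · exact ⟨(1, u), by simp [coe_signedSquareHom, hu]⟩
    · exact ⟨(-1, u), by simp [coe_signedSquareHom, ← hu]⟩
  · rintro ⟨⟨ε, u⟩, rfl⟩
    rw [coe_signedSquareHom]
    rcases Int.units_eq_one_or ε with rfl | rfl
    · exact Or.inl ⟨u, by simp⟩
    · exact Or.inr ⟨u, by simp⟩

theorem neg_mem_quadraticConnectionSet_iff {x : R} :
    -x ∈ quadraticConnectionSet R ↔ x ∈ quadraticConnectionSet R := by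
  simp only [quadraticConnectionSet, Set.mem_union, Set.mem_ofPred_eq, neg_neg]
  exact or_comm

theorem one_mem_quadraticConnectionSet : (1 : R) ∈ quadraticConnectionSet R :=
  Or.inl ⟨1, by simp⟩

variable [Fintype R]

variable (R) in
/-- The cardinality of `T_R`, which is the valency of the quadratic unitary Cayley graph. -/
noncomputable def quadraticValency : ℕ := (quadraticConnectionSet R).ncard

theorem quadraticValency_ne_zero : quadraticValency R ≠ 0 :=
  Set.ncard_ne_zero_of_mem one_mem_quadraticConnectionSet

open Classical in
theorem sum_adj_quadraticUnitaryCayleyGraph [Nontrivial R]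
    [DecidableRel (quadraticUnitaryCayleyGraph R).Adj] (u : R) (f : R → ℂ) :
    ∑ v, (if (quadraticUnitaryCayleyGraph R).Adj u v then f v else 0) =
      ∑ t, if t ∈ quadraticConnectionSet R then f (u + t) else 0 := by
  refine (Fintype.sum_equiv (Equiv.addLeft u) _ _ fun t => ?_).symm
  have : (quadraticUnitaryCayleyGraph R).Adj u (u + t) ↔ t ∈ quadraticConnectionSet R := by
    rw [quadraticUnitaryCayleyGraph_adj, sub_add_cancel_left, neg_mem_quadraticConnectionSet_iff]
  simp only [Equiv.coe_addLeft, this]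

theorem degree_quadraticUnitaryCayleyGraph [Nontrivial R]
    [DecidableRel (quadraticUnitaryCayleyGraph R).Adj] (u : R) :
    (quadraticUnitaryCayleyGraph R).degree u = quadraticValency R := by
  classical
  have h := sum_adj_quadraticUnitaryCayleyGraph u (fun _ => 1)
  rw [← Finset.sum_filter, ← Finset.sum_filter, Finset.sum_const, Finset.sum_const,
    nsmul_one, nsmul_one, Nat.cast_inj] at h
  rw [← SimpleGraph.card_neighborFinset_eq_degree, quadraticValency,
    Set.ncard_eq_toFinset_card']
  convert h using 2
  · ext; simp
  · ext; simp

open Classical in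
theorem card_mul_sum_signedSquareHom (g : R → ℂ) :
    (quadraticValency R : ℂ) * ∑ p, g (signedSquareHom R p) =
      Fintype.card (ℤˣ × Rˣ) * ∑ t, if t ∈ quadraticConnectionSet R then g t else 0 := by
  have h := card_mul_sum_comp_monoidHom_of_surjective (signedSquareHom R).rangeRestrict
    (signedSquareHom R).rangeRestrict_surjective (fun y => g ((y : Rˣ) : R))
  have hset : Set.range (fun y : (signedSquareHom R).range => ((y : Rˣ) : R)) =
      quadraticConnectionSet R := by
    ext x
    rw [mem_quadraticConnectionSet_iff]
    simp
  have hinj : Function.Injective (fun y : (signedSquareHom R).range => ((y : Rˣ) : R)) :=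
    fun a b hab => Subtype.ext (Units.ext hab)
  have hcard : Fintype.card (signedSquareHom R).range = quadraticValency R := by
    rw [quadraticValency, ← hset, Set.ncard, Set.encard, ENat.card_congr
      (Equiv.ofInjective _ hinj).symm]
    simp
  rw [hcard] at h
  refine h.trans ?_
  congr 1
  rw [← Finset.sum_filter]
  refine Finset.sum_bij (fun y _ => ((y : Rˣ) : R)) ?_ ?_ ?_ ?_
  · intro y _
    rw [Finset.mem_filter, ← hset]
    exact ⟨Finset.mem_univ _, y, rfl⟩
  · intro a _ b _ hab
    exact hinj hab
  · intro x hx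
    rw [Finset.mem_filter, ← hset] at hx
    obtain ⟨_, y, hy⟩ := hx
    exact ⟨y, Finset.mem_univ _, hy⟩
  · intro _ _
    rfl

open Classical in
/-- If `-1` is a square in `K` and `f : R → K` is surjective on units, the average over `T_R` of a
function pulled back from `K` is its average over the squares of units of `K`. -/
theorem average_quadraticConnectionSet {K : Type*} [CommRing K] [Fintype K] (f : R →+* K)
    (hf : Function.Surjective (Units.map (f : R →* K))) {w : Kˣ} (hw : w ^ 2 = -1) (g : K → ℂ) :
    (∑ t, if t ∈ quadraticConnectionSet R then g (f t) else 0) / quadraticValency R =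
      (∑ u : Kˣ, g ((u : K) ^ 2)) / Fintype.card Kˣ := by
  have h1 := card_mul_sum_signedSquareHom (fun x => g (f x))
  have h2 := card_mul_sum_comp_monoidHom_of_surjective
    (MonoidHom.prodMap (MonoidHom.id ℤˣ) (Units.map (f : R →* K)))
    (Function.surjective_id.prodMap hf) (fun p => g (signedSquareHom K p))
  have h3 : ∀ p : ℤˣ × Rˣ, (signedSquareHom K
      (MonoidHom.prodMap (MonoidHom.id ℤˣ) (Units.map (f : R →* K)) p) : K) =
      f (signedSquareHom R p) := by
    intro p
    simp [coe_signedSquareHom]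
  have h4 : ∑ p : ℤˣ × Kˣ, g (signedSquareHom K p) = 2 * ∑ u : Kˣ, g ((u : K) ^ 2) := by
    have hε : ∀ ε : ℤˣ, ∑ u : Kˣ, g (signedSquareHom K (ε, u)) = ∑ u : Kˣ, g ((u : K) ^ 2) := by
      intro ε
      rcases Int.units_eq_one_or ε with rfl | rfl
      · simp [coe_signedSquareHom]
      · refine Fintype.sum_equiv (Equiv.mulLeft w) _ _ fun u => ?_
        have hw' : (w : K) ^ 2 = -1 := by
          have := congrArg Units.val hw
          simpa using this
        simp [coe_signedSquareHom, mul_pow, hw']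
    rw [Fintype.sum_prod_type]
    simp [hε]
  simp_rw [h3] at h2
  rw [h4] at h2
  have hc : Fintype.card ℤˣ = 2 := by decide
  simp only [Fintype.card_prod, hc] at h1 h2
  push_cast at h1 h2
  have hk : (quadraticValency R : ℂ) ≠ 0 := by exact_mod_cast quadraticValency_ne_zero
  have hK : (Fintype.card Kˣ : ℂ) ≠ 0 := by exact_mod_cast Fintype.card_ne_zero
  have hR : (Fintype.card Rˣ : ℂ) ≠ 0 := by exact_mod_cast Fintype.card_ne_zero
  rw [div_eq_div_iff hk hK]
  refine mul_left_cancel₀ (mul_ne_zero (two_ne_zero (α := ℂ)) hR) ?_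
  linear_combination (-(Fintype.card Kˣ : ℂ)) * h1 + quadraticValency R / 2 * h2

open Classical in
theorem GroverWalk.IsPeriodic.isIntegral_average [Nontrivial R] [DecidableEq R]
    [DecidableRel (quadraticUnitaryCayleyGraph R).Adj]
    (h : GroverWalk.IsPeriodic (quadraticUnitaryCayleyGraph R))
    {K : Type*} [CommRing K] [Fintype K] (f : R →+* K)
    (hf : Function.Surjective (Units.map (f : R →* K))) {w : Kˣ} (hw : w ^ 2 = -1)
    (ψ : AddChar K ℂ) :
    IsIntegral ℤ (2 * ((∑ u : Kˣ, ψ ((u : K) ^ 2)) / Fintype.card Kˣ)) := by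
  have hk : (quadraticValency R : ℂ) ≠ 0 := by exact_mod_cast quadraticValency_ne_zero
  have havg := average_quadraticConnectionSet f hf hw ψ
  have hne : (fun x => ψ (f x)) ≠ (0 : R → ℂ) := fun h0 => by simpa using congrFun h0 0
  refine h.isIntegral (k := quadraticValency R) degree_quadraticUnitaryCayleyGraph
    quadraticValency_ne_zero hne fun u => ?_
  have hadj := sum_adj_quadraticUnitaryCayleyGraph u (fun x => ψ (f x))
  rw [hadj, ← havg, mul_div_cancel₀ _ hk, Finset.sum_mul]
  refine Finset.sum_congr rfl fun t _ => ?_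
  split_ifs
  · rw [map_add, AddChar.map_add_eq_mul, mul_comm]
  · rw [zero_mul]

end Cayley

/-! ### Gauss sums over finite fields -/

section FiniteField

variable {F : Type*} [Field F] [Fintype F] [DecidableEq F]

/-- The quadratic character with complex values. -/
noncomputable def complexQuadraticChar (F : Type*) [Field F] [Fintype F] [DecidableEq F] : MulChar F ℂ :=
  (quadraticChar F).ringHomComp (Int.castRingHom ℂ)

theorem sum_addChar_sq_eq_gaussSum (hF : ringChar F ≠ 2) {ψ : AddChar F ℂ} (hψ : ψ ≠ 1) :
    ∑ u : Fˣ, ψ ((u : F) ^ 2) = gaussSum (complexQuadraticChar F) ψ - 1 := by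
  have h0 : ∑ x : F, ψ (x ^ 2) = 1 + ∑ u : Fˣ, ψ ((u : F) ^ 2) := by
    rw [← Finset.add_sum_erase _ _ (Finset.mem_univ (0 : F))]
    congr 1
    · simp
    · refine (Finset.sum_bij (fun (u : Fˣ) _ => (u : F)) ?_ ?_ ?_ ?_).symm
      · intro u _
        simp
      · intro a _ b _ hab
        exact Units.ext hab
      · intro b hb
        exact ⟨Units.mk0 b (Finset.ne_of_mem_erase hb), Finset.mem_univ _, rfl⟩
      · intro _ _
        rfl
  have h1 : ∑ x : F, ψ (x ^ 2) = ∑ y, (complexQuadraticChar F y + 1) * ψ y := by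
    rw [← Finset.sum_fiberwise (g := fun x : F => x ^ 2)]
    refine Finset.sum_congr rfl fun y _ => ?_
    rw [Finset.sum_congr rfl (g := fun _ => ψ y)
      (fun x hx => by rw [(Finset.mem_filter.1 hx).2]), Finset.sum_const, nsmul_eq_mul]
    congr 1
    have h := congrArg (Int.cast : ℤ → ℂ) (quadraticChar_card_sqrts hF y)
    push_cast at h
    rw [complexQuadraticChar, MulChar.ringHomComp_apply, eq_intCast, ← h]
    congr 2
    ext x
    simp
  have h2 : ∑ y, (complexQuadraticChar F y + 1) * ψ y = gaussSum (complexQuadraticChar F) ψ := by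
    simp_rw [add_mul, one_mul]
    rw [Finset.sum_add_distrib, AddChar.sum_eq_zero_of_ne_one hψ, add_zero]
    rfl
  rw [← h2, ← h1, h0, add_sub_cancel_left]

/-- For `q ≡ 1 mod 4` there are additive characters for which the sum over squares of units is
`g - 1` and `-g - 1`, where `g ^ 2 = q`. -/
theorem exists_addChar_sum_sq (hq : Fintype.card F ≡ 1 [MOD 4]) :
    ∃ (g : ℂ) (ψ φ : AddChar F ℂ), g ^ 2 = Fintype.card F ∧
      ∑ u : Fˣ, ψ ((u : F) ^ 2) = g - 1 ∧ ∑ u : Fˣ, φ ((u : F) ^ 2) = -g - 1 := by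
  have hq' : Fintype.card F % 4 = 1 := hq
  have hF : ringChar F ≠ 2 := by
    intro h
    have := FiniteField.even_card_of_char_two h
    omega
  have hprim := AddChar.FiniteField.primitiveChar_to_Complex_isPrimitive F
  set ψ := AddChar.FiniteField.primitiveChar_to_Complex F
  obtain ⟨c, hc⟩ := quadraticChar_exists_neg_one' hF
  have hcc : complexQuadraticChar F c = -1 := by
    simp [complexQuadraticChar, MulChar.ringHomComp_apply, hc]
  have hψ : ψ ≠ 1 := by
    have := hprim one_ne_zero
    rwa [AddChar.mulShift_one] at this
  have hquad : (complexQuadraticChar F).IsQuadratic :=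
    (quadraticChar_isQuadratic F).comp _
  have hne : complexQuadraticChar F ≠ 1 := by
    intro h
    rw [h, MulChar.one_apply_coe] at hcc
    norm_num at hcc
  have hneg : complexQuadraticChar F (-1) = 1 := by
    have hs : IsSquare (-1 : F) := FiniteField.isSquare_neg_one_iff.2 (by omega)
    rw [complexQuadraticChar, MulChar.ringHomComp_apply,
      (quadraticChar_one_iff_isSquare (neg_ne_zero.2 one_ne_zero)).2 hs]
    simp
  refine ⟨gaussSum (complexQuadraticChar F) ψ, ψ, ψ.mulShift c, ?_,
    sum_addChar_sq_eq_gaussSum hF hψ, ?_⟩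
  · rw [gaussSum_sq hne hquad hprim, hneg, one_mul]
  · rw [sum_addChar_sq_eq_gaussSum hF (hprim c.ne_zero)]
    have := gaussSum_mulShift (complexQuadraticChar F) ψ c
    rw [hcc] at this
    rw [← this]
    ring

omit [DecidableEq F] in
theorem exists_units_sq_eq_neg_one (hq : Fintype.card F ≡ 1 [MOD 4]) :
    ∃ w : Fˣ, w ^ 2 = -1 := by
  have hq' : Fintype.card F % 4 = 1 := hq
  obtain ⟨w, hw⟩ : IsSquare (-1 : F) := FiniteField.isSquare_neg_one_iff.2 (by omega)
  have hw0 : w ≠ 0 := by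
    rintro rfl
    simp at hw
  exact ⟨Units.mk0 w hw0, Units.ext (by simp [hw, pow_two])⟩

end FiniteField

/-! ### Products of residue fields -/

section Product

variable {ι : Type*} [Fintype ι] [DecidableEq ι] {K : ι → Type*}

/-- The product of a family of additive characters. -/
noncomputable def piAddChar [∀ i, CommRing (K i)] (ψ : ∀ i, AddChar (K i) ℂ) : AddChar (∀ i, K i) ℂ where
  toFun x := ∏ i, ψ i (x i)
  map_zero_eq_one' := by simp
  map_add_eq_mul' x y := by simp [AddChar.map_add_eq_mul, Finset.prod_mul_distrib]

theorem average_piAddChar [∀ i, CommRing (K i)] [∀ i, Fintype (K i)] [∀ i, DecidableEq (K i)]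
    [Fintype (∀ i, K i)ˣ] (ψ : ∀ i, AddChar (K i) ℂ) :
    (∑ u : (∀ i, K i)ˣ, piAddChar ψ ((u : ∀ i, K i) ^ 2)) / Fintype.card (∀ i, K i)ˣ =
      ∏ i, ((∑ u : (K i)ˣ, ψ i ((u : K i) ^ 2)) / Fintype.card (K i)ˣ) := by
  rw [Finset.prod_div_distrib]
  congr 1
  · rw [Finset.prod_univ_sum, Fintype.piFinset_univ]
    exact Fintype.sum_equiv MulEquiv.piUnits.toEquiv _ _ fun u => rfl
  · rw [Fintype.card_congr (MulEquiv.piUnits (M := K)).toEquiv, Fintype.card_pi]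
    push_cast
    rfl

theorem eq_five_of_isIntegral_product [∀ i, Field (K i)] [∀ i, Fintype (K i)]
    [∀ i, DecidableEq (K i)]
    (hq : ∀ i, Fintype.card (K i) ≡ 1 [MOD 4])
    (h : ∀ ψ : ∀ i, AddChar (K i) ℂ,
      IsIntegral ℤ (2 * ∏ i, ((∑ u : (K i)ˣ, ψ i ((u : K i) ^ 2)) / Fintype.card (K i)ˣ))) :
    (∀ i, Fintype.card (K i) = 5) ∧ Subsingleton ι := by
  choose g ψ φ hg hψ hφ using fun i => exists_addChar_sum_sq (hq i)
  have hint : ∀ {a b : ℤ}, b ≠ 0 → IsIntegral ℤ ((a : ℂ) / b) → b ∣ a := by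
    intro a b hb hab
    have h1 : IsIntegral ℤ ((a : ℚ) / b) := by
      rw [← isIntegral_algebraMap_iff (A := ℚ) (B := ℂ) (algebraMap ℚ ℂ).injective]
      simpa using hab
    obtain ⟨z, hz⟩ := IsIntegrallyClosed.isIntegral_iff.1 h1
    have hb' : (b : ℚ) ≠ 0 := by exact_mod_cast hb
    refine ⟨z, ?_⟩
    rw [eq_div_iff hb'] at hz
    have : (a : ℚ) = b * z := by rw [← hz]; simp [mul_comm]
    exact_mod_cast this
  have hcu : ∀ i, (Fintype.card (K i)ˣ : ℂ) = Fintype.card (K i) - 1 := by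
    intro i
    rw [Fintype.card_units, Nat.cast_sub Fintype.card_pos, Nat.cast_one]
  have htriv : ∀ i, (∑ u : (K i)ˣ, (1 : AddChar (K i) ℂ) ((u : K i) ^ 2)) /
      Fintype.card (K i)ˣ = 1 := by
    intro i
    have : (Fintype.card (K i)ˣ : ℂ) ≠ 0 := by exact_mod_cast Fintype.card_ne_zero
    simp
  have hfive : ∀ i, Fintype.card (K i) = 5 := by
    intro i
    have hone : ∀ χ : AddChar (K i) ℂ, IsIntegral ℤ (2 * ((∑ u : (K i)ˣ, χ ((u : K i) ^ 2)) /
        Fintype.card (K i)ˣ)) := by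
      intro χ
      have := h (Function.update (fun _ => 1) i χ)
      rw [Fintype.prod_eq_single i fun j hj => ?_] at this
      · simpa using this
      · rw [Function.update_of_ne hj]
        exact htriv j
    have hmul := (hone (ψ i)).mul (hone (φ i))
    rw [hψ, hφ, hcu] at hmul
    have hpos : 1 < Fintype.card (K i) := Fintype.one_lt_card
    have hmod : Fintype.card (K i) % 4 = 1 := hq i
    obtain ⟨m, hm⟩ : ∃ m, Fintype.card (K i) = 4 * m + 1 := ⟨Fintype.card (K i) / 4, by omega⟩
    have hm0 : m ≠ 0 := by omega
    have hm0' : (m : ℂ) ≠ 0 := by exact_mod_cast hm0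
    have hgi : g i ^ 2 = 4 * m + 1 := by rw [hg, hm]; push_cast; ring
    have hval : 2 * ((g i - 1) / ((Fintype.card (K i) : ℂ) - 1)) *
        (2 * ((-g i - 1) / ((Fintype.card (K i) : ℂ) - 1))) = ((-1 : ℤ) : ℂ) / (m : ℤ) := by
      rw [hm]
      push_cast
      rw [add_sub_cancel_right]
      field_simp
      linear_combination -4 * hgi
    rw [hval] at hmul
    have hdvd := hint (by exact_mod_cast hm0) hmul
    have : m ∣ 1 := by
      have := Int.natAbs_dvd_natAbs.2 hdvd
      simpa using this
    have := Nat.dvd_one.1 this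
    omega
  refine ⟨hfive, ⟨fun i j => ?_⟩⟩
  by_contra hij
  have hpair : ∀ (χ : AddChar (K i) ℂ) (χ' : AddChar (K j) ℂ),
      IsIntegral ℤ (2 * ((∑ u : (K i)ˣ, χ ((u : K i) ^ 2)) / 4 *
        ((∑ u : (K j)ˣ, χ' ((u : K j) ^ 2)) / 4))) := by
    intro χ χ'
    have := h (Function.update (Function.update (fun _ => 1) i χ) j χ')
    rw [Fintype.prod_eq_mul i j hij fun l hl => ?_] at this
    · rw [Function.update_of_ne hij, Function.update_self, Function.update_self, hcu, hcu,
        hfive, hfive] at this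
      convert this using 4 <;> norm_num
    · rw [Function.update_of_ne hl.2, Function.update_of_ne hl.1]
      exact htriv l
  have hi := hg i
  have hj := hg j
  rw [hfive] at hi hj
  have hhalf : IsIntegral ℤ (((-1 : ℤ) : ℂ) / (2 : ℤ)) := by
    rcases sq_eq_sq_iff_eq_or_eq_neg.1 (hj.trans hi.symm) with hij' | hij'
    · have := hpair (ψ i) (φ j)
      rw [hψ, hφ, hij'] at this
      convert this using 1
      push_cast at hi ⊢
      linear_combination (1 / 8) * hi
    · have := hpair (ψ i) (ψ j)
      rw [hψ, hψ, hij'] at this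
      convert this using 1
      push_cast at hi ⊢
      linear_combination (1 / 8) * hi
  have := hint two_ne_zero hhalf
  norm_num at this

theorem GroverWalk.IsPeriodic.card_eq_five_and_subsingleton [∀ i, Field (K i)]
    [∀ i, Fintype (K i)] (hq : ∀ i, Fintype.card (K i) ≡ 1 [MOD 4])
    {R : Type*} [CommRing R] [Fintype R] [Nontrivial R] [DecidableEq R]
    [DecidableRel (quadraticUnitaryCayleyGraph R).Adj]
    (h : GroverWalk.IsPeriodic (quadraticUnitaryCayleyGraph R)) (f : R →+* ∀ i, K i)
    (hf : Function.Surjective (Units.map (f : R →* ∀ i, K i))) :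
    (∀ i, Fintype.card (K i) = 5) ∧ Subsingleton ι := by
  classical
  choose w hw using fun i => exists_units_sq_eq_neg_one (hq i)
  have hw' : (MulEquiv.piUnits.symm w : (∀ i, K i)ˣ) ^ 2 = -1 := by
    refine Units.ext (funext fun i => ?_)
    simpa using congrArg Units.val (hw i)
  refine eq_five_of_isIntegral_product hq fun ψ => ?_
  rw [← average_piAddChar]
  convert h.isIntegral_average f hf hw' (piAddChar ψ)

end Product

/-! ### Local rings with residue field of order five -/

section ResidueFive

variable {R : Type*} [CommRing R] [Fintype R] (π : R →+* ZMod 5)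

theorem exists_sq_eq_of_map_eq_one [IsLocalHom π] {x : R} (hx : π x = 1) :
    ∃ u : Rˣ, x = (u : R) ^ 2 := by
  have hinj : Function.Injective (fun y : {y : R // π y = 1} =>
      (⟨(y : R) ^ 2, by rw [map_pow, y.2, one_pow]⟩ : {y : R // π y = 1})) := by
    rintro ⟨a, ha⟩ ⟨b, hb⟩ hab
    have h : a ^ 2 = b ^ 2 := congrArg Subtype.val hab
    have hu : IsUnit (a + b) := by
      apply isUnit_of_map_unit π
      rw [map_add, ha, hb]
      decide
    have h0 : (a + b) * (a - b) = 0 := by linear_combination h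
    exact Subtype.ext (sub_eq_zero.1 ((hu.mul_right_eq_zero).1 h0))
  obtain ⟨⟨u, hu⟩, h⟩ := Finite.surjective_of_injective hinj ⟨x, hx⟩
  have huu : IsUnit u := isUnit_of_map_unit π _ (by rw [hu]; exact isUnit_one)
  exact ⟨huu.unit, (congrArg Subtype.val h).symm⟩

theorem mem_quadraticConnectionSet_iff_of_isLocalHom [IsLocalHom π] {x : R} :
    x ∈ quadraticConnectionSet R ↔ π x = 1 ∨ π x = -1 := by
  have hsq : ∀ z : (ZMod 5)ˣ, (z : ZMod 5) ^ 2 = 1 ∨ (z : ZMod 5) ^ 2 = -1 := by decide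
  constructor
  · rintro (⟨u, rfl⟩ | ⟨u, hu⟩)
    · rw [map_pow]
      exact hsq (Units.map (π : R →* ZMod 5) u)
    · rw [neg_eq_iff_eq_neg] at hu
      subst hu
      rw [map_neg, map_pow, neg_inj, neg_eq_iff_eq_neg]
      exact (hsq (Units.map (π : R →* ZMod 5) u)).symm
  · rintro (h | h)
    · exact Or.inl (exists_sq_eq_of_map_eq_one π h)
    · exact Or.inr (exists_sq_eq_of_map_eq_one π (by rw [map_neg, h, neg_neg]))

/-- The matrix on `R` pulled back from the circulant matrix of `a` on `ZMod 5`. -/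
noncomputable def pullbackCirculant (a : ZMod 5 → ℂ) : Matrix R R ℂ :=
  Matrix.of fun u v => a (π (u - v))

theorem pullbackCirculant_mul (hπ : Function.Surjective π) (a b : ZMod 5 → ℂ) :
    pullbackCirculant π a * pullbackCirculant π b =
      pullbackCirculant π fun z => (Fintype.card R / 5 : ℂ) * ∑ w, a (z - w) * b w := by
  ext u v
  have h := card_mul_sum_comp_addMonoidHom_of_surjective π.toAddMonoidHom hπ
    (fun w => a (π (u - v) - w) * b w)
  rw [ZMod.card] at h
  simp only [pullbackCirculant, Matrix.mul_apply, Matrix.of_apply]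
  have hs : ∑ x, a (π (u - x)) * b (π (x - v)) =
      ∑ x, a (π (u - v) - π.toAddMonoidHom x) * b (π.toAddMonoidHom x) := by
    refine Fintype.sum_equiv (Equiv.subRight v) _ _ fun x => ?_
    simp only [Equiv.subRight_apply, RingHom.toAddMonoidHom_eq_coe, AddMonoidHom.coe_coe]
    rw [← map_sub, sub_sub_sub_cancel_right]
  rw [hs]
  push_cast at h
  linear_combination h / 5

/-- The indicator function of `{1, -1}` in `ZMod 5`. -/
def pentagonIndicator (z : ZMod 5) : ℤ := if z = 1 ∨ z = -1 then 1 else 0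

theorem sum_pentagonIndicator : ∑ w, pentagonIndicator w = 2 := by decide

theorem sum_pentagonIndicator_mul_add (z : ZMod 5) :
    ∑ w, pentagonIndicator (z - w) * pentagonIndicator w + pentagonIndicator z =
      1 + if z = 0 then 1 else 0 := by
  revert z
  decide

theorem sum_one_add_mul_pentagonIndicator (z : ZMod 5) :
    ∑ w, (1 + if z - w = 0 then 1 else 0) * pentagonIndicator w = 2 + pentagonIndicator z := by
  revert z
  decide

theorem five_mul_quadraticValency [IsLocalHom π] (hπ : Function.Surjective π) :
    (5 * quadraticValency R : ℂ) = 2 * Fintype.card R := by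
  classical
  have h := card_mul_sum_comp_addMonoidHom_of_surjective π.toAddMonoidHom hπ
    (fun w => (pentagonIndicator w : ℂ))
  have hsum : ∑ w, (pentagonIndicator w : ℂ) = 2 := by
    rw [← Int.cast_sum, sum_pentagonIndicator, Int.cast_ofNat]
  have hk : ∑ x, (pentagonIndicator (π x) : ℂ) = quadraticValency R := by
    have hc : ∀ x, (pentagonIndicator (π x) : ℂ) =
        if x ∈ quadraticConnectionSet R then 1 else 0 := by
      intro x
      simp [pentagonIndicator, mem_quadraticConnectionSet_iff_of_isLocalHom π]
    simp_rw [hc]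
    rw [Finset.sum_boole, quadraticValency, Set.ncard_eq_toFinset_card']
    congr 2
    ext
    simp
  rw [ZMod.card, hsum] at h
  rw [← hk]
  push_cast at h
  exact h.trans (mul_comm _ _)

theorem isPeriodic_of_residueField_five [DecidableEq R]
    [DecidableRel (quadraticUnitaryCayleyGraph R).Adj] [IsLocalHom π]
    (hπ : Function.Surjective π) :
    GroverWalk.IsPeriodic (quadraticUnitaryCayleyGraph R) := by
  have : Fact (Nat.Prime 5) := ⟨by norm_num⟩
  have : Nontrivial R := π.domain_nontrivial
  have hcard := five_mul_quadraticValency π hπ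
  have hk0 : (quadraticValency R : ℂ) ≠ 0 := by exact_mod_cast quadraticValency_ne_zero
  set k := quadraticValency R with hk
  have hm : (Fintype.card R / 5 : ℂ) = k / 2 := by linear_combination -hcard / 10
  set P := pullbackCirculant π (fun z => (pentagonIndicator z : ℂ) / k) with hP
  have e1 : (4 : ℂ) • (P * P) + (2 : ℂ) • P = pullbackCirculant π
      (fun z => ((1 + if z = 0 then 1 else 0 : ℤ) : ℂ) * (2 / k)) := by
    rw [hP, pullbackCirculant_mul π hπ, hm]
    ext u v
    simp only [pullbackCirculant, Matrix.add_apply, Matrix.smul_apply, Matrix.of_apply,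
      smul_eq_mul]
    rw [← sum_pentagonIndicator_mul_add]
    simp only [div_mul_div_comm, ← Finset.sum_div]
    push_cast
    field_simp
    ring
  have e2 : ((4 : ℂ) • (P * P) + (2 : ℂ) • P - 1) * P = pullbackCirculant π (fun _ => 2 / k) := by
    rw [Matrix.sub_mul, e1, hP, pullbackCirculant_mul π hπ, hm, Matrix.one_mul]
    ext u v
    simp only [pullbackCirculant, Matrix.sub_apply, Matrix.of_apply]
    have := congrArg (Int.cast : ℤ → ℂ) (sum_one_add_mul_pentagonIndicator (π (u - v)))
    have hs : ∀ w : ZMod 5, (((1 + if π (u - v) - w = 0 then 1 else 0 : ℤ) : ℂ) * (2 / k)) *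
        ((pentagonIndicator w : ℂ) / k) =
        (((1 + if π (u - v) - w = 0 then 1 else 0) * pentagonIndicator w : ℤ) : ℂ) *
          (2 / k ^ 2) := by
      intro w
      rw [Int.cast_mul]
      field_simp
    simp_rw [hs]
    rw [← Finset.sum_mul, ← Int.cast_sum, this]
    push_cast
    field_simp
    ring
  have e3 : pullbackCirculant π (fun _ => (2 / k : ℂ)) * P =
      pullbackCirculant π (fun _ => 2 / k) := by
    rw [hP, pullbackCirculant_mul π hπ, hm]
    ext u v
    simp only [pullbackCirculant, Matrix.of_apply]
    rw [← Finset.mul_sum, ← Finset.sum_div, ← Int.cast_sum, sum_pentagonIndicator]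
    push_cast
    field_simp
  refine GroverWalk.isPeriodic_of_discriminant (k := k) degree_quadraticUnitaryCayleyGraph
    quadraticValency_ne_zero (P := P) (fun u v => ?_) ?_
  · rw [hP]
    simp only [pullbackCirculant, Matrix.of_apply, quadraticUnitaryCayleyGraph_adj,
      mem_quadraticConnectionSet_iff_of_isLocalHom π, pentagonIndicator]
    split_ifs <;> simp
  · rw [e2, Matrix.mul_sub, e3, Matrix.mul_one, sub_self]

end ResidueFive

theorem theorem5p4 {R : Type*} [CommRing R] [Fintype R] [DecidableEq R]
    [DecidableRel (quadraticUnitaryCayleyGraph R).Adj]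
    {s : ℕ} (hs : 0 < s) (L : Fin s → Type*) [∀ i, CommRing (L i)] [∀ i, IsLocalRing (L i)]
    (e : R ≃+* ((i : Fin s) → L i))
    (hL : ∀ i, Nat.card (IsLocalRing.ResidueField (L i)) ≡ 1 [MOD 4]) :
    GroverWalk.IsPeriodic (quadraticUnitaryCayleyGraph R) ↔
      s = 1 ∧ Nonempty (IsLocalRing.ResidueField (L ⟨0, hs⟩) ≃+* ZMod 5) := by
  classical
  have : Fact (Nat.Prime 5) := ⟨by norm_num⟩
  have : Finite (∀ i, L i) := Finite.of_equiv R e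
  have hfinL : ∀ i, Finite (L i) := fun i =>
    Finite.of_surjective (fun x : ∀ i, L i => x i) (Function.surjective_eval i)
  have hfinK : ∀ i, Finite (IsLocalRing.ResidueField (L i)) := fun i =>
    Finite.of_surjective _ IsLocalRing.residue_surjective
  let _ : ∀ i, Fintype (IsLocalRing.ResidueField (L i)) := fun i => Fintype.ofFinite _
  have hq : ∀ i, Fintype.card (IsLocalRing.ResidueField (L i)) ≡ 1 [MOD 4] := by
    intro i
    rw [← Nat.card_eq_fintype_card]
    exact hL i
  constructor
  · intro h
    have : Nontrivial (∀ i, L i) := Pi.nontrivial_at (⟨0, hs⟩ : Fin s)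
    have : Nontrivial R := e.toEquiv.nontrivial
    let f : R →+* ∀ i, IsLocalRing.ResidueField (L i) :=
      (RingHom.pi fun i => (IsLocalRing.residue (L i)).comp (Pi.evalRingHom L i)).comp e.toRingHom
    have hf : Function.Surjective
        (Units.map (f : R →* ∀ i, IsLocalRing.ResidueField (L i))) := by
      intro y
      have hlift : ∀ i, ∃ x : (L i)ˣ,
          IsLocalRing.residue (L i) x = (MulEquiv.piUnits y i : IsLocalRing.ResidueField (L i)) := by
        intro i
        obtain ⟨x, hx⟩ := IsLocalRing.surjective_units_map_of_local_ringHom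
          (IsLocalRing.residue (L i)) IsLocalRing.residue_surjective inferInstance
          (MulEquiv.piUnits y i)
        exact ⟨x, congrArg Units.val hx⟩
      choose x hx using hlift
      refine ⟨Units.map (e.symm : _ →* R) (MulEquiv.piUnits.symm x), Units.ext (funext fun i => ?_)⟩
      simpa [f] using hx i
    obtain ⟨h5, hsub⟩ := GroverWalk.IsPeriodic.card_eq_five_and_subsingleton hq h f hf
    refine ⟨?_, ?_⟩
    · have := Fintype.card_le_one_iff_subsingleton.2 hsub
      rw [Fintype.card_fin] at this
      omega
    · exact ⟨FiniteField.ringEquivOfCardEq (by rw [h5, ZMod.card])⟩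
  · rintro ⟨rfl, ⟨g⟩⟩
    let ev : R ≃+* L ⟨0, hs⟩ := e.trans (RingEquiv.piUnique L)
    let π : R →+* ZMod 5 :=
      (g.toRingHom.comp (IsLocalRing.residue (L ⟨0, hs⟩))).comp ev.toRingHom
    have hπ : Function.Surjective π :=
      (g.surjective.comp IsLocalRing.residue_surjective).comp ev.surjective
    have : IsLocalHom π := by
      refine ⟨fun a ha => ?_⟩
      have h1 : IsUnit (IsLocalRing.residue (L ⟨0, hs⟩) (ev a)) :=
        (MulEquiv.isUnit_map g).1 ha
      exact (MulEquiv.isUnit_map ev).1 (isUnit_of_map_unit _ _ h1)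
    exact isPeriodic_of_residueField_five π hπ
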